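/- All groups are discrete. For $i=1,2$ let $X_i$ be a locally compact metrizable space that is connected, locally path-connected and semi-locally simply connected, let $G_i$ be a group acting faithfully on $X_i$ by homeomorphisms, and let $P_i:\widetilde X_i\to X_i$ be the universal covering. The action groupoid $G_i\ltimes X_i$ is the topological groupoid $G_i\times X_i$ with unit space $X_i$ in which $(g,x)$ is an arrow from $x$ to $g\cdot x$ and $(g,h\cdot x)(h,x)=(gh,x)$. Topological groupoids $\mathfrak G$, $\mathfrak H$ are equivalent if there is a locally compact Hausdorff space $\mathfrak B$ with commuting free proper left $\mathfrak G$- and right $\mathfrak H$-actions over continuous open maps $\mathfrak B\to\mathfrak G^{(0)}$ and $\mathfrak B\to\mathfrak H^{(0)}$ which induce bijections $\mathfrak B/\mathfrak H\to\mathfrak G^{(0)}$ and $\mathfrak G\backslash\mathfrak B\to\mathfrak H^{(0)}$. The lift of the action $(G_i,X_i)$ to the universal covering is the group $\widetilde G_i$ of all homeomorphisms $h$ of $\widetilde X_i$ for which there is $g\in G_i$ with $P_i(h(x))=g\cdot P_i(x)$ for all $x\in\widetilde X_i$, acting on $\widetilde X_i$. Then the groupoids $G_1\ltimes X_1$ and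 $G_2\ltimes X_2$ are equivalent if and only if the actions $(\widetilde G_1,\widetilde X_1)$ and $(\widetilde G_2,\widetilde X_2)$ are topologically conjugate, that is, if and only if there exist a homeomorphism $F:\widetilde X_1\to\widetilde X_2$ and a group isomorphism $\varphi:\widetilde G_1\to\widetilde G_2$ such that $F(h(x))=\varphi(h)(F(x))$ for all $x\in\widetilde X_1$ and $h\in\widetilde G_1$. -/

import Mathlib

open Topology

universe u v a c

/-- A topological groupoid with space of units `X` and space of arrows `A`. An arrow `g` goes from
its origin `o g` to its target `t g`, and the product `g h` is defined if and only if
`o g = t h`. The unit at `x` is `one x`; all operations are continuous (so `one` is a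
homeomorphism onto the subspace of units). -/
structure TopGroupoid (X A : Type*) [TopologicalSpace X] [TopologicalSpace A] where
  o : A → X
  t : A → X
  one : X → A
  inv : A → A
  mul : (g h : A) → o g = t h → A
  o_one : ∀ x, o (one x) = x
  t_one : ∀ x, t (one x) = x
  o_inv : ∀ g, o (inv g) = t g
  t_inv : ∀ g, t (inv g) = o g
  o_mul : ∀ g h (e : o g = t h), o (mul g h e) = o h
  t_mul : ∀ g h (e : o g = t h), t (mul g h e) = t g
  mul_assoc : ∀ g h k (e₁ : o g = t h) (e₂ : o h = t k),
    mul (mul g h e₁) k ((o_mul g h e₁).trans e₂) = mul g (mul h k e₂) (e₁.trans (t_mul h k e₂).symm)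
  mul_one : ∀ g, mul g (one (o g)) (t_one (o g)).symm = g
  one_mul : ∀ g, mul (one (t g)) g (o_one (t g)) = g
  inv_mul : ∀ g, mul (inv g) g (o_inv g) = one (o g)
  mul_inv : ∀ g, mul g (inv g) (t_inv g).symm = one (t g)
  continuous_o : Continuous o
  continuous_t : Continuous t
  continuous_one : Continuous one
  continuous_inv : Continuous inv
  continuous_mul : Continuous fun p : {p : A × A // o p.1 = t p.2} => mul p.1.1 p.1.2 p.2

namespace TopGroupoid

/-- A left action of the groupoid `𝔊` on the space `B` over a continuous open map `P`; `g • b` is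
defined if and only if `o g = P b`. -/
structure LeftAction {X A : Type*} [TopologicalSpace X] [TopologicalSpace A]
    (𝔊 : TopGroupoid X A) (B : Type*) [TopologicalSpace B] where
  P : B → X
  continuous_P : Continuous P
  isOpenMap_P : IsOpenMap P
  act : (g : A) → (b : B) → 𝔊.o g = P b → B
  P_act : ∀ g b (e : 𝔊.o g = P b), P (act g b e) = 𝔊.t g
  one_act : ∀ b, act (𝔊.one (P b)) b (𝔊.o_one (P b)) = b
  mul_act : ∀ g h b (e₁ : 𝔊.o g = 𝔊.t h) (e₂ : 𝔊.o h = P b),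
    act (𝔊.mul g h e₁) b ((𝔊.o_mul g h e₁).trans e₂) =
      act g (act h b e₂) (e₁.trans (P_act h b e₂).symm)
  continuous_act : Continuous fun p : {p : A × B // 𝔊.o p.1 = P p.2} => act p.1.1 p.1.2 p.2

/-- A right action of the groupoid `𝔊` on the space `B` over a continuous open map `P`; `b • g` is
defined if and only if `P b = t g`. -/
structure RightAction {X A : Type*} [TopologicalSpace X] [TopologicalSpace A]
    (𝔊 : TopGroupoid X A) (B : Type*) [TopologicalSpace B] where
  P : B → X
  continuous_P : Continuous P
  isOpenMap_P : IsOpenMap P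
  act : (b : B) → (g : A) → P b = 𝔊.t g → B
  P_act : ∀ b g (e : P b = 𝔊.t g), P (act b g e) = 𝔊.o g
  act_one : ∀ b, act b (𝔊.one (P b)) (𝔊.t_one (P b)).symm = b
  act_mul : ∀ b g h (e₁ : P b = 𝔊.t g) (e₂ : 𝔊.o g = 𝔊.t h),
    act b (𝔊.mul g h e₂) (e₁.trans (𝔊.t_mul g h e₂).symm) =
      act (act b g e₁) h ((P_act b g e₁).trans e₂)
  continuous_act : Continuous fun p : {p : B × A // P p.1 = 𝔊.t p.2} => act p.1.1 p.1.2 p.2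

section

variable {X A B : Type*} [TopologicalSpace X] [TopologicalSpace A] [TopologicalSpace B]

/-- Only units fix points. -/
def LeftAction.IsFree {𝔊 : TopGroupoid X A} (L : 𝔊.LeftAction B) : Prop :=
  ∀ g b (e : 𝔊.o g = L.P b), L.act g b e = b → ∃ x, g = 𝔊.one x

/-- The map (target, origin) from the action groupoid to `B × B` is proper. -/
def LeftAction.IsProper {𝔊 : TopGroupoid X A} (L : 𝔊.LeftAction B) : Prop :=
  IsProperMap fun p : {p : A × B // 𝔊.o p.1 = L.P p.2} => (L.act p.1.1 p.1.2 p.2, p.1.2)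

/-- Only units fix points. -/
def RightAction.IsFree {𝔊 : TopGroupoid X A} (R : 𝔊.RightAction B) : Prop :=
  ∀ b g (e : R.P b = 𝔊.t g), R.act b g e = b → ∃ x, g = 𝔊.one x

/-- The map (target, origin) from the action groupoid to `B × B` is proper. -/
def RightAction.IsProper {𝔊 : TopGroupoid X A} (R : 𝔊.RightAction B) : Prop :=
  IsProperMap fun p : {p : B × A // R.P p.1 = 𝔊.t p.2} => (p.1.1, R.act p.1.1 p.1.2 p.2)

end

/-- A `(𝔊, ℌ)`-equivalence carried by the space `B`: commuting free proper left `𝔊`-action and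
right `ℌ`-action whose base maps induce bijections `B / ℌ → X` and `𝔊 \ B → Y`, where `X` and `Y`
are the unit spaces. -/
structure Equivalence {X A Y C : Type*} [TopologicalSpace X] [TopologicalSpace A]
    [TopologicalSpace Y] [TopologicalSpace C] (𝔊 : TopGroupoid X A) (ℌ : TopGroupoid Y C)
    (B : Type*) [TopologicalSpace B] where
  left : 𝔊.LeftAction B
  right : ℌ.RightAction B
  left_isFree : left.IsFree
  left_isProper : left.IsProper
  right_isFree : right.IsFree
  right_isProper : right.IsProper
  /-- If `g • b` and `b • h` are defined, then `(g • b) • h` and `g • (b • h)` are defined and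
  are equal. -/
  commute : ∀ g b h (e₁ : 𝔊.o g = left.P b) (e₂ : right.P b = ℌ.t h),
    ∃ (e₃ : right.P (left.act g b e₁) = ℌ.t h) (e₄ : 𝔊.o g = left.P (right.act b h e₂)),
      right.act (left.act g b e₁) h e₃ = left.act g (right.act b h e₂) e₄
  left_P_surjective : Function.Surjective left.P
  left_P_eq_iff : ∀ b b', left.P b = left.P b' ↔ ∃ h e, right.act b h e = b'
  right_P_surjective : Function.Surjective right.P
  right_P_eq_iff : ∀ b b', right.P b = right.P b' ↔ ∃ g e, left.act g b e = b'

/-- Two topological groupoids are equivalent if there is an equivalence between them carried by a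
locally compact Hausdorff space. -/
def AreEquivalent {X : Type u} {A : Type a} {Y : Type v} {C : Type c}
    [TopologicalSpace X] [TopologicalSpace A] [TopologicalSpace Y] [TopologicalSpace C]
    (𝔊 : TopGroupoid X A) (ℌ : TopGroupoid Y C) : Prop :=
  ∃ (B : Type (max a c)) (_ : TopologicalSpace B) (_ : LocallyCompactSpace B) (_ : T2Space B),
    Nonempty (Equivalence 𝔊 ℌ B)

end TopGroupoid

/-- The groupoid `G ⋉ X` of an action of a discrete group `G` on `X` by homeomorphisms: the
arrow `(g, x)` goes from `x` to `g • x`, and `(g, h • x) (h, x) = (g h, x)`. -/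
def actionGroupoid (G X : Type*) [Group G] [TopologicalSpace G] [DiscreteTopology G]
    [TopologicalSpace X] [MulAction G X] [ContinuousConstSMul G X] : TopGroupoid X (G × X) where
  o p := p.2
  t p := p.1 • p.2
  one x := (1, x)
  inv p := (p.1⁻¹, p.1 • p.2)
  mul p q _ := (p.1 * q.1, q.2)
  o_one _ := rfl
  t_one x := one_smul G x
  o_inv _ := rfl
  t_inv p := inv_smul_smul p.1 p.2
  o_mul _ _ _ := rfl
  t_mul p q e := by simp only [mul_smul, e]
  mul_assoc p q r _ _ := by simp only [mul_assoc]
  mul_one p := by simp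
  one_mul p := by simp
  inv_mul p := by simp
  mul_inv p := by simp
  continuous_o := continuous_snd
  continuous_t := continuous_prod_of_discrete_left.mpr continuous_const_smul
  continuous_one := by fun_prop
  continuous_inv := by
    refine (continuous_of_discreteTopology.comp continuous_fst).prodMk ?_
    exact continuous_prod_of_discrete_left.mpr continuous_const_smul
  continuous_mul := by
    refine Continuous.prodMk ?_ (by fun_prop)
    exact (continuous_of_discreteTopology (f := fun p : G × G => p.1 * p.2)).comp
      (Continuous.prodMk (by fun_prop) (by fun_prop))

/-- Every point has a neighbourhood `U` such that every loop in `U` based at that point is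
null-homotopic in the whole space. -/
def IsSemilocallySimplyConnected (X : Type*) [TopologicalSpace X] : Prop :=
  ∀ x : X, ∃ U ∈ 𝓝 x, ∀ γ : Path x x, Set.range γ ⊆ U → γ.Homotopic (Path.refl x)

/-- `p : E → X` is the universal covering of the (path-connected) space `X`. -/
structure IsUniversalCovering {E X : Type*} [TopologicalSpace E] [TopologicalSpace X]
    (p : E → X) : Prop where
  isCoveringMap : IsCoveringMap p
  surjective : Function.Surjective p
  simplyConnected : SimplyConnectedSpace E

/-- The tautological action of the group of self-homeomorphisms. -/
instance homeomorphMulAction (E : Type*) [TopologicalSpace E] : MulAction (E ≃ₜ E) E where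
  smul h e := h e
  one_smul _ := rfl
  mul_smul _ _ _ := rfl

/-- The lift of `G` along `p : E → X`: the group of all homeomorphisms of `E` that cover the action
on `X` of some element of `G`. -/
def liftOfAction (G : Type*) {E X : Type*} [Group G] [TopologicalSpace E] [TopologicalSpace X]
    [MulAction G X] (p : E → X) : Subgroup (E ≃ₜ E) where
  carrier := {h | ∃ g : G, ∀ e, p (h e) = g • p e}
  mul_mem' := by
    rintro h k ⟨g, hg⟩ ⟨g', hg'⟩
    exact ⟨g * g', fun e => (hg (k e)).trans (by rw [hg', mul_smul])⟩
  one_mem' := ⟨1, fun e => (one_smul G (p e)).symm⟩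
  inv_mem' := by
    rintro h ⟨g, hg⟩
    refine ⟨g⁻¹, fun e => ?_⟩
    rw [eq_inv_smul_iff, ← hg]
    exact congrArg p (h.apply_symm_apply e)

/-- Topological conjugacy of the group actions `(G, X)` and `(H, Y)`. -/
def TopologicallyConjugate (G X H Y : Type*) [Group G] [TopologicalSpace X] [MulAction G X]
    [Group H] [TopologicalSpace Y] [MulAction H Y] : Prop :=
  ∃ (F : X ≃ₜ Y) (φ : G ≃* H), ∀ (g : G) (x : X), F (g • x) = φ g • F x

/-! An equivalence of action groupoids is the same as a bicovering: a space `B` with commuting free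
proper actions of `G₁` and `G₂`, where `P₁ : B → X₁` is the quotient covering by `G₂` and `P₂ : B →
X₂` the quotient covering by `G₁` (`Equivalence.isBicovering`, `IsBicovering.nonempty_equivalence`).

Given a bicovering, both universal coverings factor through one component of `B`, so they are
identified by a homeomorphism `F`, with a map `q : E₁ → B` over both bases. If `f` covers `g₁` on
`X₁`, then `q ∘ f` and `g₁ • q` have the same image under `P₁`, so they differ by a deck
transformation `g₂ ∈ G₂`. Applying `P₂`, which is `G₁`-invariant, shows that `f` covers `g₂` on
`X₂`. By symmetry `F` conjugates one lift onto the other.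

Conversely, after transport along `F` both lifts are one group `Γ` of homeomorphisms of a single
space `E`. By faithfulness each element of `Γ` covers a unique element of each `Gᵢ`, so `Γ` acts on
`G₁ × E × G₂`, and the quotient is a bicovering (`isQuotientCoveringMap_of_correspondence`). -/

/-! ### Coverings and proper actions -/

open Filter in
/-- The total space of a quotient covering map over a Hausdorff space carries a proper action. -/
theorem IsQuotientCoveringMap.properSMul {G B X : Type*} [Group G] [TopologicalSpace G]
    [DiscreteTopology G] [TopologicalSpace B] [MulAction G B] [TopologicalSpace X] [T2Space X]
    {P : B → X} (hP : IsQuotientCoveringMap P G) : ProperSMul G B := by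
  have := hP.toContinuousConstSMul
  have hcont : Continuous fun p : G × B => p.1 • p.2 :=
    continuous_prod_of_discrete_left.mpr continuous_const_smul
  refine ⟨isProperMap_iff_ultrafilter.mpr ⟨hcont.prodMk continuous_snd, ?_⟩⟩
  rintro 𝒰 ⟨b', b⟩ h
  rw [nhds_prod_eq] at h
  have h₁ : Tendsto (fun p : G × B => p.1 • p.2) 𝒰 (𝓝 b') := h.fst
  have h₂ : Tendsto (fun p : G × B => p.2) 𝒰 (𝓝 b) := h.snd
  have hPc := hP.isCoveringMap.continuous
  have hPb : P b' = P b := by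
    refine tendsto_nhds_unique ((hPc.tendsto b').comp h₁)
      (((hPc.tendsto b).comp h₂).congr fun p => ?_)
    exact (hP.map_smul p.1).symm
  obtain ⟨g, rfl⟩ := hP.apply_eq_iff_mem_orbit.mp hPb
  refine ⟨(g, b), rfl, ?_⟩
  -- Along the ultrafilter both `p.1 • p.2` and `g • p.2` end up in `V`, which is disjoint from its
  -- nontrivial translates; hence eventually `p.1 = g`.
  obtain ⟨V, hV, hdisj⟩ := hP.disjoint (g • b)
  have hfst : Tendsto (fun p : G × B => p.1) 𝒰 (𝓝 g) := by
    rw [nhds_discrete, tendsto_pure]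
    filter_upwards [h₁ hV, (((continuous_const_smul g).tendsto b).comp h₂) hV] with p hp hp'
    refine mul_inv_eq_one.mp (hdisj (p.1 * g⁻¹) ⟨p.1 • p.2, ⟨g • p.2, hp', ?_⟩, hp⟩)
    simp [mul_smul]
  rw [nhds_prod_eq]
  exact hfst.prodMk h₂

/-- The total space of a covering of a Hausdorff space is a Hausdorff space. -/
theorem IsCoveringMap.t2Space {B X : Type*} [TopologicalSpace B] [TopologicalSpace X] [T2Space X]
    {P : B → X} (hP : IsCoveringMap P) : T2Space B := by
  refine ⟨fun b b' hne => ?_⟩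
  by_cases h : P b = P b'
  · exact hP.isSeparatedMap b b' h hne
  · exact separated_by_continuous hP.continuous h

/-- The local inverses of a covering map form an atlas. -/
@[reducible] noncomputable def IsCoveringMap.chartedSpace {B X : Type*} [TopologicalSpace B]
    [TopologicalSpace X] {P : B → X} (hP : IsCoveringMap P) : ChartedSpace X B where
  atlas := Set.range fun b => (hP.isLocalHomeomorph b).choose
  chartAt b := (hP.isLocalHomeomorph b).choose
  mem_chart_source b := (hP.isLocalHomeomorph b).choose_spec.1
  chart_mem_atlas b := ⟨b, rfl⟩

/-- Commuting actions of `G₁` and `G₂` on `B` together with equivariant maps `P₁ : B → X₁` and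
`P₂ : B → X₂` such that `P₁` is the quotient covering by `G₂` and `P₂` is the quotient covering by
`G₁`. -/
structure IsBicovering (G₁ G₂ : Type*) {B X₁ X₂ : Type*} [Group G₁] [Group G₂]
    [TopologicalSpace B] [TopologicalSpace X₁] [TopologicalSpace X₂] [MulAction G₁ B]
    [MulAction G₂ B] [MulAction G₁ X₁] [MulAction G₂ X₂] (P₁ : B → X₁) (P₂ : B → X₂) : Prop where
  smul_comm : ∀ (g₁ : G₁) (g₂ : G₂) (b : B), g₁ • g₂ • b = g₂ • g₁ • b
  fst : IsQuotientCoveringMap P₁ G₂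
  snd : IsQuotientCoveringMap P₂ G₁
  fst_smul : ∀ (g : G₁) b, P₁ (g • b) = g • P₁ b
  snd_smul : ∀ (g : G₂) b, P₂ (g • b) = g • P₂ b

/-! ### Actions of `G ⋉ X` as equivariant actions of `G` -/

namespace TopGroupoid

section

variable {G X B : Type*} [Group G] [TopologicalSpace G] [DiscreteTopology G] [TopologicalSpace X]
  [MulAction G X] [ContinuousConstSMul G X] [TopologicalSpace B]

/-- The left action of `G ⋉ X` given by a `G`-action and an equivariant open map. -/
def LeftAction.ofMulAction [MulAction G B] [ContinuousConstSMul G B] (P : B → X)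
    (hP : Continuous P) (hP' : IsOpenMap P) (h : ∀ (g : G) b, P (g • b) = g • P b) :
    (actionGroupoid G X).LeftAction B where
  P := P
  continuous_P := hP
  isOpenMap_P := hP'
  act γ b _ := γ.1 • b
  P_act γ b e := (h γ.1 b).trans (congrArg (γ.1 • ·) e.symm)
  one_act b := one_smul G b
  mul_act γ δ b _ _ := mul_smul γ.1 δ.1 b
  continuous_act := by
    have : Continuous fun p : G × B => p.1 • p.2 :=
      continuous_prod_of_discrete_left.mpr continuous_const_smul
    exact this.comp (by fun_prop :
      Continuous fun p : {p : (G × X) × B // (actionGroupoid G X).o p.1 = P p.2} =>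
        (p.1.1.1, p.1.2))

/-- The right action of `G ⋉ X` given by a `G`-action and an equivariant open map. -/
def RightAction.ofMulAction [MulAction G B] [ContinuousConstSMul G B] (P : B → X)
    (hP : Continuous P) (hP' : IsOpenMap P) (h : ∀ (g : G) b, P (g • b) = g • P b) :
    (actionGroupoid G X).RightAction B where
  P := P
  continuous_P := hP
  isOpenMap_P := hP'
  act b γ _ := γ.1⁻¹ • b
  P_act b γ e := (h γ.1⁻¹ b).trans (inv_smul_eq_iff.mpr e)
  act_one b := by simp [actionGroupoid]
  act_mul b γ δ _ _ := by simp [actionGroupoid, mul_smul]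
  continuous_act := by
    have : Continuous fun p : G × B => p.1⁻¹ • p.2 :=
      continuous_prod_of_discrete_left.mpr fun g => continuous_const_smul g⁻¹
    exact this.comp (by fun_prop :
      Continuous fun p : {p : B × (G × X) // P p.1 = (actionGroupoid G X).t p.2} =>
        (p.1.2.1, p.1.1))

theorem LeftAction.act_congr {X A B : Type*} [TopologicalSpace X] [TopologicalSpace A]
    [TopologicalSpace B] {𝔊 : TopGroupoid X A} (L : 𝔊.LeftAction B) {g g' : A} {b b' : B}
    (hg : g = g') (hb : b = b') (e : 𝔊.o g = L.P b) (e' : 𝔊.o g' = L.P b') :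
    L.act g b e = L.act g' b' e' := by
  subst hg hb
  rfl

theorem RightAction.act_congr {X A B : Type*} [TopologicalSpace X] [TopologicalSpace A]
    [TopologicalSpace B] {𝔊 : TopGroupoid X A} (R : 𝔊.RightAction B) {g g' : A} {b b' : B}
    (hg : g = g') (hb : b = b') (e : R.P b = 𝔊.t g) (e' : R.P b' = 𝔊.t g') :
    R.act b g e = R.act b' g' e' := by
  subst hg hb
  rfl

/-- The group action underlying a left action of an action groupoid. -/
@[reducible] def LeftAction.mulAction (L : (actionGroupoid G X).LeftAction B) : MulAction G B where
  smul g b := L.act (g, L.P b) b rfl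
  one_smul b := L.one_act b
  mul_smul g h b := by
    refine (L.mul_act (g, h • L.P b) (h, L.P b) b rfl rfl).trans (L.act_congr ?_ rfl _ _)
    exact congrArg (g, ·) (L.P_act (h, L.P b) b rfl).symm

/-- Inversion turns the right groupoid action into a left group action: `g` acts on `b` through the
arrow `(g⁻¹, g • R.P b)`, whose target is `R.P b`. -/
theorem RightAction.P_eq_t (R : (actionGroupoid G X).RightAction B) (g : G) (b : B) :
    R.P b = (actionGroupoid G X).t (g⁻¹, g • R.P b) :=
  (inv_smul_smul g (R.P b)).symm

/-- The group action underlying a right action of an action groupoid. -/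
@[reducible] def RightAction.mulAction (R : (actionGroupoid G X).RightAction B) :
    MulAction G B where
  smul g b := R.act b (g⁻¹, g • R.P b) (R.P_eq_t g b)
  one_smul b := by
    refine Eq.trans (R.act_congr ?_ rfl _ _) (R.act_one b)
    simp [actionGroupoid]
  mul_smul g h b := by
    have hP : R.P (R.act b (h⁻¹, h • R.P b) (R.P_eq_t h b)) = h • R.P b := R.P_act _ _ _
    refine Eq.trans (R.act_congr ?_ rfl _ ?_) ((R.act_mul b (h⁻¹, h • R.P b)
      (g⁻¹, (g * h) • R.P b) (R.P_eq_t h b) ?_).trans (R.act_congr ?_ rfl _ _))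
    · simp [actionGroupoid]
    · simp [actionGroupoid, mul_smul]
    · simp [actionGroupoid, mul_smul]
    · exact congrArg (g⁻¹, ·) ((mul_smul g h _).trans (congrArg (g • ·) hP.symm))

theorem LeftAction.continuousConstSMul (L : (actionGroupoid G X).LeftAction B) :
    letI := L.mulAction
    ContinuousConstSMul G B := by
  let := L.mulAction
  refine ⟨fun g => ?_⟩
  have hP := L.continuous_P
  exact L.continuous_act.comp (Continuous.subtype_mk
    (by fun_prop : Continuous fun b : B => ((g, L.P b), b)) fun b => rfl)

theorem RightAction.continuousConstSMul (R : (actionGroupoid G X).RightAction B) :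
    letI := R.mulAction
    ContinuousConstSMul G B := by
  let := R.mulAction
  refine ⟨fun g => ?_⟩
  have hP := R.continuous_P
  exact R.continuous_act.comp (Continuous.subtype_mk
    (by fun_prop : Continuous fun b : B => (b, (g⁻¹, g • R.P b))) fun b => R.P_eq_t g b)

/-- The arrows of the action groupoid of a left action of `G ⋉ X` on `B`. -/
def leftArrowsHomeomorph {P : B → X} (hP : Continuous P) :
    G × B ≃ₜ {p : (G × X) × B // (actionGroupoid G X).o p.1 = P p.2} where
  toFun p := ⟨((p.1, P p.2), p.2), rfl⟩
  invFun p := (p.1.1.1, p.1.2)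
  left_inv _ := rfl
  right_inv := by
    rintro ⟨⟨⟨g, x⟩, b⟩, rfl : x = P b⟩
    rfl
  continuous_toFun := by fun_prop
  continuous_invFun := by fun_prop

/-- The arrows of the action groupoid of a right action of `G ⋉ X` on `B`. -/
def rightArrowsHomeomorph {P : B → X} (hP : Continuous P) :
    G × B ≃ₜ {p : B × (G × X) // P p.1 = (actionGroupoid G X).t p.2} where
  toFun p := ⟨(p.2, (p.1⁻¹, p.1 • P p.2)), (inv_smul_smul p.1 (P p.2)).symm⟩
  invFun p := (p.1.2.1⁻¹, p.1.1)
  left_inv _ := by simp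
  right_inv := by
    rintro ⟨⟨b, g, x⟩, h : P b = g • x⟩
    simp [h]
  continuous_toFun := by
    have : Continuous fun p : G × X => p.1 • p.2 :=
      continuous_prod_of_discrete_left.mpr continuous_const_smul
    have h₁ : Continuous fun p : G × B => p.1 • P p.2 :=
      this.comp (by fun_prop : Continuous fun p : G × B => (p.1, P p.2))
    have h₂ : Continuous fun p : G × B => p.1⁻¹ :=
      (continuous_of_discreteTopology (f := fun g : G => g⁻¹)).comp continuous_fst
    exact Continuous.subtype_mk (by fun_prop) _
  continuous_invFun := by
    have : Continuous fun p : {p : B × (G × X) // P p.1 = (actionGroupoid G X).t p.2} =>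
        p.1.2.1⁻¹ :=
      (continuous_of_discreteTopology (f := fun g : G => g⁻¹)).comp (by fun_prop)
    exact this.prodMk (by fun_prop)

/-- The base point of an arrow acting on `b` is determined by `b`, so the composable pairs are just
`G × B` and the two notions of properness agree. -/
theorem LeftAction.IsProper.properSMul {L : (actionGroupoid G X).LeftAction B}
    (hL : L.IsProper) :
    letI := L.mulAction
    ProperSMul G B := by
  let := L.mulAction
  exact ⟨hL.comp (leftArrowsHomeomorph L.continuous_P).isProperMap⟩

theorem RightAction.IsProper.properSMul {R : (actionGroupoid G X).RightAction B}
    (hR : R.IsProper) :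
    letI := R.mulAction
    ProperSMul G B := by
  let := R.mulAction
  -- The right-handed properness map lists the original point first, whereas `ProperSMul` lists it
  -- second.
  exact ⟨(Homeomorph.prodComm B B).isProperMap.comp
    (hR.comp (rightArrowsHomeomorph R.continuous_P).isProperMap)⟩

theorem LeftAction.isProper_ofMulAction [MulAction G B] [ContinuousConstSMul G B] [ProperSMul G B]
    {P : B → X} (hP : Continuous P) (hP' : IsOpenMap P) (h : ∀ (g : G) b, P (g • b) = g • P b) :
    (LeftAction.ofMulAction P hP hP' h).IsProper :=
  (ProperSMul.isProperMap_smul_pair (G := G) (X := B)).comp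
    (leftArrowsHomeomorph hP).symm.isProperMap

theorem RightAction.isProper_ofMulAction [MulAction G B] [ContinuousConstSMul G B] [ProperSMul G B]
    {P : B → X} (hP : Continuous P) (hP' : IsOpenMap P) (h : ∀ (g : G) b, P (g • b) = g • P b) :
    (RightAction.ofMulAction P hP hP' h).IsProper :=
  (Homeomorph.prodComm B B).isProperMap.comp
    ((ProperSMul.isProperMap_smul_pair (G := G) (X := B)).comp
      (rightArrowsHomeomorph hP).symm.isProperMap)

theorem LeftAction.IsFree.isCancelSMul {L : (actionGroupoid G X).LeftAction B} (hL : L.IsFree) :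
    letI := L.mulAction
    IsCancelSMul G B := by
  let := L.mulAction
  refine isCancelSMul_iff_eq_one_of_smul_eq.mpr fun g b hgb => ?_
  obtain ⟨x, hx⟩ := hL (g, L.P b) b rfl hgb
  exact congrArg Prod.fst hx

theorem RightAction.IsFree.isCancelSMul {R : (actionGroupoid G X).RightAction B}
    (hR : R.IsFree) :
    letI := R.mulAction
    IsCancelSMul G B := by
  let := R.mulAction
  refine isCancelSMul_iff_eq_one_of_smul_eq.mpr fun g b hgb => ?_
  obtain ⟨x, hx⟩ := hR b (g⁻¹, g • R.P b) (R.P_eq_t g b) hgb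
  exact inv_eq_one.mp (congrArg Prod.fst hx)

end

section

variable {G₁ G₂ X₁ X₂ B : Type*} [TopologicalSpace X₁] [TopologicalSpace X₂] [Group G₁]
  [TopologicalSpace G₁] [DiscreteTopology G₁] [MulAction G₁ X₁] [ContinuousConstSMul G₁ X₁]
  [Group G₂] [TopologicalSpace G₂] [DiscreteTopology G₂] [MulAction G₂ X₂]
  [ContinuousConstSMul G₂ X₂] [TopologicalSpace B]

/-- On a locally compact Hausdorff space, a free proper action of a discrete group is properly
discontinuous, so its quotient map is a covering. The two bijectivity axioms identify the fibres of
each base map with the orbits of the opposite group. -/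
theorem Equivalence.isBicovering [LocallyCompactSpace B] [T2Space B]
    (e : Equivalence (actionGroupoid G₁ X₁) (actionGroupoid G₂ X₂) B) :
    letI := e.left.mulAction
    letI := e.right.mulAction
    IsBicovering G₁ G₂ e.left.P e.right.P := by
  let := e.left.mulAction
  let := e.right.mulAction
  have := e.left.continuousConstSMul
  have := e.right.continuousConstSMul
  have := e.left_isFree.isCancelSMul
  have := e.right_isFree.isCancelSMul
  have := properlyDiscontinuousSMul_iff_properSMul.mpr e.left_isProper.properSMul
  have := properlyDiscontinuousSMul_iff_properSMul.mpr e.right_isProper.properSMul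
  have hl : IsOpenQuotientMap e.left.P :=
    ⟨e.left_P_surjective, e.left.continuous_P, e.left.isOpenMap_P⟩
  have hr : IsOpenQuotientMap e.right.P :=
    ⟨e.right_P_surjective, e.right.continuous_P, e.right.isOpenMap_P⟩
  have hlP (g : G₁) (b : B) : e.left.P (g • b) = g • e.left.P b := e.left.P_act (g, e.left.P b) b rfl
  have hrP (g : G₂) (b : B) : e.right.P (g • b) = g • e.right.P b :=
    e.right.P_act b (g⁻¹, g • e.right.P b) (e.right.P_eq_t g b)
  have hl_iff {b b' : B} : e.left.P b = e.left.P b' ↔ b ∈ MulAction.orbit G₂ b' := by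
    rw [eq_comm, e.left_P_eq_iff]
    constructor
    · rintro ⟨⟨g, x⟩, h : e.right.P b' = g • x, rfl⟩
      refine ⟨g⁻¹, e.right.act_congr ?_ rfl _ _⟩
      simp [h]
    · rintro ⟨g, rfl⟩
      exact ⟨(g⁻¹, g • e.right.P b'), e.right.P_eq_t g b', rfl⟩
  have hr_iff {b b' : B} : e.right.P b = e.right.P b' ↔ b ∈ MulAction.orbit G₁ b' := by
    rw [eq_comm, e.right_P_eq_iff]
    constructor
    · rintro ⟨⟨g, x⟩, rfl : x = e.left.P b', rfl⟩
      exact ⟨g, rfl⟩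
    · rintro ⟨g, rfl⟩
      exact ⟨(g, e.left.P b'), rfl, rfl⟩
  refine ⟨fun g₁ g₂ b => ?_, ?_, ?_, hlP, hrP⟩
  · obtain ⟨_, _, h⟩ := e.commute (g₁, e.left.P b) b (g₂⁻¹, g₂ • e.right.P b) rfl
      (e.right.P_eq_t g₂ b)
    have h₁ : e.left.P (g₂ • b) = e.left.P b := hl_iff.mpr ⟨g₂, rfl⟩
    have h₂ : e.right.P (g₁ • b) = e.right.P b := hr_iff.mpr ⟨g₁, rfl⟩
    refine Eq.trans (e.left.act_congr ?_ rfl _ _) (h.symm.trans (e.right.act_congr ?_ rfl _ _))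
    · rw [h₁]
    · rw [h₂]
  · exact hl.isQuotientMap.isQuotientCoveringMap_of_properlyDiscontinuousSMul hl_iff
  · exact hr.isQuotientMap.isQuotientCoveringMap_of_properlyDiscontinuousSMul hr_iff

end

end TopGroupoid

/-! ### From bicoverings back to equivalences -/

namespace IsBicovering

open TopGroupoid

variable {G₁ G₂ X₁ X₂ B : Type*} [TopologicalSpace X₁] [TopologicalSpace X₂] [Group G₁]
  [TopologicalSpace G₁] [DiscreteTopology G₁] [MulAction G₁ X₁] [ContinuousConstSMul G₁ X₁]
  [Group G₂] [TopologicalSpace G₂] [DiscreteTopology G₂] [MulAction G₂ X₂]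
  [ContinuousConstSMul G₂ X₂] [TopologicalSpace B] [MulAction G₁ B] [MulAction G₂ B]

/-- Properness is the only analytic point; it comes from the covering property over Hausdorff bases.
-/
theorem nonempty_equivalence [T2Space X₁] [T2Space X₂] {P₁ : B → X₁} {P₂ : B → X₂}
    (h : IsBicovering G₁ G₂ P₁ P₂) :
    Nonempty (Equivalence (actionGroupoid G₁ X₁) (actionGroupoid G₂ X₂) B) := by
  have := h.fst.toContinuousConstSMul
  have := h.snd.toContinuousConstSMul
  have := h.fst.isCancelSMul
  have := h.snd.isCancelSMul
  have := h.fst.properSMul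
  have := h.snd.properSMul
  have h₁ := h.fst.isOpenQuotientMap
  have h₂ := h.snd.isOpenQuotientMap
  exact ⟨{
    left := LeftAction.ofMulAction P₁ h₁.continuous h₁.isOpenMap h.fst_smul
    right := RightAction.ofMulAction P₂ h₂.continuous h₂.isOpenMap h.snd_smul
    left_isFree := by
      rintro ⟨g, x⟩ b _ (hb : g • b = b)
      exact ⟨x, congrArg (·, x) (isCancelSMul_iff_eq_one_of_smul_eq.mp ‹_› g b hb)⟩
    left_isProper := LeftAction.isProper_ofMulAction _ _ _
    right_isFree := by
      rintro b ⟨g, x⟩ _ (hb : g⁻¹ • b = b)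
      exact ⟨x, congrArg (·, x)
        (inv_eq_one.mp (isCancelSMul_iff_eq_one_of_smul_eq.mp ‹_› g⁻¹ b hb))⟩
    right_isProper := RightAction.isProper_ofMulAction _ _ _
    commute := fun γ b δ e₁ e₂ =>
      ⟨(h.snd.map_smul γ.1).trans e₂, e₁.trans (h.fst.map_smul δ.1⁻¹).symm,
        (h.smul_comm γ.1 δ.1⁻¹ b).symm⟩
    left_P_surjective := h.fst.surjective
    left_P_eq_iff := fun b b' => by
      change P₁ b = P₁ b' ↔ _
      rw [eq_comm, h.fst.apply_eq_iff_mem_orbit]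
      constructor
      · rintro ⟨g, rfl⟩
        exact ⟨(g⁻¹, g • P₂ b), (inv_smul_smul g (P₂ b)).symm, by
          simp [RightAction.ofMulAction]⟩
      · rintro ⟨γ, _, rfl⟩
        exact ⟨γ.1⁻¹, rfl⟩
    right_P_surjective := h.snd.surjective
    right_P_eq_iff := fun b b' => by
      change P₂ b = P₂ b' ↔ _
      rw [eq_comm, h.snd.apply_eq_iff_mem_orbit]
      constructor
      · rintro ⟨g, rfl⟩
        exact ⟨(g, P₁ b), rfl, rfl⟩
      · rintro ⟨γ, _, rfl⟩
        exact ⟨γ.1, rfl⟩ }⟩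

end IsBicovering

/-! ### Lifting maps through universal coverings -/

section Lifting

variable {E X : Type*} [TopologicalSpace E] [TopologicalSpace X]

theorem IsUniversalCovering.comp_homeomorph {p : E → X} (hp : IsUniversalCovering p)
    {E' : Type*} [TopologicalSpace E'] (F : E' ≃ₜ E) : IsUniversalCovering (p ∘ F) where
  isCoveringMap := hp.isCoveringMap.comp_homeomorph F
  surjective := hp.surjective.comp F.surjective
  simplyConnected := by
    have := hp.simplyConnected
    exact F.toHomotopyEquiv.simplyConnectedSpace

theorem IsUniversalCovering.homeomorph_comp {p : E → X} (hp : IsUniversalCovering p)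
    {X' : Type*} [TopologicalSpace X'] (F : X ≃ₜ X') : IsUniversalCovering (F ∘ p) where
  isCoveringMap := hp.isCoveringMap.homeomorph_comp F
  surjective := F.surjective.comp hp.surjective
  simplyConnected := hp.simplyConnected

/-- If `B` covers both `X₁` and `X₂`, then the universal coverings of `X₁` and `X₂` are
homeomorphic, compatibly with a common map to `B`. -/
theorem IsUniversalCovering.exists_homeomorph_of_common_cover {X₁ X₂ E₁ E₂ B : Type*}
    [TopologicalSpace X₁] [TopologicalSpace X₂] [TopologicalSpace E₁] [TopologicalSpace E₂]
    [TopologicalSpace B] [LocallyPathConnectedSpace X₁] [LocallyPathConnectedSpace X₂]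
    {p₁ : E₁ → X₁} {p₂ : E₂ → X₂} (hp₁ : IsUniversalCovering p₁) (hp₂ : IsUniversalCovering p₂)
    {P₁ : B → X₁} {P₂ : B → X₂} (hP₁ : IsCoveringMap P₁) (hP₂ : IsCoveringMap P₂)
    (b : B) (e₁ : E₁) (e₂ : E₂) (h₁ : P₁ b = p₁ e₁) (h₂ : P₂ b = p₂ e₂) :
    ∃ (F : E₁ ≃ₜ E₂) (q : C(E₁, B)), F e₁ = e₂ ∧ P₁ ∘ q = p₁ ∧ P₂ ∘ q = p₂ ∘ F := by
  have := hp₁.simplyConnected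
  have := hp₂.simplyConnected
  -- The charts pass local path-connectedness from the bases to the covers, as the lifting criterion
  -- requires.
  let := hp₁.isCoveringMap.chartedSpace
  have := ChartedSpace.locallyPathConnectedSpace X₁ E₁
  let := hp₂.isCoveringMap.chartedSpace
  have := ChartedSpace.locallyPathConnectedSpace X₂ E₂
  have c₁ := hp₁.isCoveringMap.continuous
  have c₂ := hp₂.isCoveringMap.continuous
  obtain ⟨q₁, ⟨hq₁, hPq₁⟩, -⟩ := hP₁.existsUnique_continuousMap_lifts ⟨p₁, c₁⟩ e₁ b h₁
  obtain ⟨q₂, ⟨hq₂, hPq₂⟩, -⟩ := hP₂.existsUnique_continuousMap_lifts ⟨p₂, c₂⟩ e₂ b h₂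
  obtain ⟨F, ⟨hF, hpF⟩, -⟩ := hp₂.isCoveringMap.existsUnique_continuousMap_lifts
    ⟨P₂ ∘ q₁, hP₂.continuous.comp q₁.continuous⟩ e₁ e₂ (by simp [hq₁, h₂])
  obtain ⟨F', ⟨hF', hpF'⟩, -⟩ := hp₁.isCoveringMap.existsUnique_continuousMap_lifts
    ⟨P₁ ∘ q₂, hP₁.continuous.comp q₂.continuous⟩ e₂ e₁ (by simp [hq₂, h₁])
  replace hPq₁ : P₁ ∘ q₁ = p₁ := hPq₁
  replace hPq₂ : P₂ ∘ q₂ = p₂ := hPq₂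
  replace hpF : p₂ ∘ F = P₂ ∘ q₁ := hpF
  replace hpF' : p₁ ∘ F' = P₁ ∘ q₂ := hpF'
  -- Both sides lift `P₂ ∘ q₁` through `P₂` and agree at `e₁`. The three identities that follow rest
  -- on the same uniqueness of lifts.
  have hqF : q₂ ∘ F = q₁ := by
    refine hP₂.eq_of_comp_eq (by fun_prop) (by fun_prop) ?_ e₁ (by simp [hF, hq₁, hq₂])
    rw [← Function.comp_assoc, hPq₂, hpF]
  have hqF' : q₁ ∘ F' = q₂ := by
    refine hP₁.eq_of_comp_eq (by fun_prop) (by fun_prop) ?_ e₂ (by simp [hF', hq₁, hq₂])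
    rw [← Function.comp_assoc, hPq₁, hpF']
  have hFF : F' ∘ F = id := by
    refine hp₁.isCoveringMap.eq_of_comp_eq (by fun_prop) (by fun_prop) ?_ e₁ (by simp [hF, hF'])
    rw [← Function.comp_assoc, hpF', Function.comp_assoc, hqF, hPq₁, Function.comp_id]
  have hFF' : F ∘ F' = id := by
    refine hp₂.isCoveringMap.eq_of_comp_eq (by fun_prop) (by fun_prop) ?_ e₂ (by simp [hF, hF'])
    rw [← Function.comp_assoc, hpF, Function.comp_assoc, hqF', hPq₂, Function.comp_id]
  exact ⟨⟨⟨F, F', congrFun hFF, congrFun hFF'⟩, F.continuous, F'.continuous⟩, q₁, hF, hPq₁,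
    hpF.symm⟩

/-- Universal coverings of the same space are isomorphic, with prescribed value at a point. -/
theorem IsUniversalCovering.exists_homeomorph {E' : Type*} [TopologicalSpace E']
    [LocallyPathConnectedSpace X] {p : E → X} {p' : E' → X} (hp : IsUniversalCovering p)
    (hp' : IsUniversalCovering p') (e : E) (e' : E') (h : p e = p' e') :
    ∃ F : E ≃ₜ E', F e = e' ∧ ∀ x, p' (F x) = p x := by
  -- The common cover is `E'` itself, with both projections equal to `p'`.
  obtain ⟨F, q, hF, h₁, h₂⟩ := hp.exists_homeomorph_of_common_cover hp' hp'.isCoveringMap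
    hp'.isCoveringMap e' e e' h.symm rfl
  exact ⟨F, hF, fun x => (congrFun h₂ x).symm.trans (congrFun h₁ x)⟩

theorem IsUniversalCovering.homeomorph_eq_refl {p : E → X} (hp : IsUniversalCovering p)
    {h : E ≃ₜ E} (hh : ∀ x, p (h x) = p x) {e : E} (he : h e = e) : h = Homeomorph.refl E := by
  have := hp.simplyConnected
  exact Homeomorph.ext (congrFun (hp.isCoveringMap.eq_of_comp_eq h.continuous continuous_id
    (funext hh) e he))

end Lifting

/-! ### Conjugacy of tautological actions -/

/-- A homeomorphism conjugating the group `S` of homeomorphisms onto the group `T` is a topological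
conjugacy of the tautological actions. -/
theorem topologicallyConjugate_of_mem_iff {E E' : Type*} [TopologicalSpace E] [TopologicalSpace E']
    {S : Subgroup (E ≃ₜ E)} {T : Subgroup (E' ≃ₜ E')} (F : E ≃ₜ E')
    (h : ∀ f : E ≃ₜ E, f ∈ S ↔ F.symm.trans (f.trans F) ∈ T) :
    TopologicallyConjugate S E T E' := by
  have key (f : E' ≃ₜ E') : F.symm.trans ((F.trans (f.trans F.symm)).trans F) = f := by
    ext; simp
  refine ⟨F, {
    toFun := fun f => ⟨F.symm.trans (f.1.trans F), (h f.1).mp f.2⟩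
    invFun := fun f => ⟨F.trans (f.1.trans F.symm), (h _).mpr (by rw [key]; exact f.2)⟩
    left_inv := fun f => Subtype.ext (Homeomorph.ext fun x => by simp)
    right_inv := fun f => Subtype.ext (key f.1)
    map_mul' := fun f g => Subtype.ext (Homeomorph.ext fun x => by simp) }, fun f x => ?_⟩
  exact congrArg (fun y => F (f.1 y)) (F.symm_apply_apply x).symm

/-- Equivariance forces `φ f = F ∘ f ∘ F⁻¹`, so the isomorphism carries no information beyond `F`.
-/
theorem TopologicallyConjugate.exists_mem_iff {E E' : Type*} [TopologicalSpace E]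
    [TopologicalSpace E'] {S : Subgroup (E ≃ₜ E)} {T : Subgroup (E' ≃ₜ E')}
    (h : TopologicallyConjugate S E T E') :
    ∃ F : E ≃ₜ E', ∀ f : E ≃ₜ E, f ∈ S ↔ F.symm.trans (f.trans F) ∈ T := by
  obtain ⟨F, φ, hF⟩ := h
  refine ⟨F, fun f => ⟨fun hf => ?_, fun hf => ?_⟩⟩
  · convert (φ ⟨f, hf⟩).2
    refine Homeomorph.ext fun x => ?_
    refine (hF ⟨f, hf⟩ (F.symm x)).trans ?_
    rw [F.apply_symm_apply]
    rfl
  · obtain ⟨f', hf'⟩ := φ.surjective ⟨_, hf⟩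
    convert f'.2
    refine Homeomorph.ext fun x => F.injective ?_
    refine Eq.trans ?_ (hF f' x).symm
    rw [hf']
    exact congrArg (fun y => F (f y)) (F.symm_apply_apply x).symm

/-! ### A bicovering makes the lifts conjugate -/

namespace IsBicovering

variable {G₁ G₂ B X₁ X₂ : Type*} [Group G₁] [Group G₂]
  [TopologicalSpace B] [TopologicalSpace X₁] [TopologicalSpace X₂] [MulAction G₁ B]
  [MulAction G₂ B] [MulAction G₁ X₁] [MulAction G₂ X₂] {P₁ : B → X₁} {P₂ : B → X₂}

theorem symm (h : IsBicovering G₁ G₂ P₁ P₂) : IsBicovering G₂ G₁ P₂ P₁ :=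
  ⟨fun g₂ g₁ b => (h.smul_comm g₁ g₂ b).symm, h.snd, h.fst, h.snd_smul, h.fst_smul⟩

/-- A self-map of a connected space over `B` that covers an element of `G₁` on `X₁` covers an
element of `G₂` on `X₂`. -/
theorem exists_smul_eq (h : IsBicovering G₁ G₂ P₁ P₂) {E : Type*} [TopologicalSpace E]
    [ConnectedSpace E] (q : C(E, B)) (f : C(E, E)) (g₁ : G₁)
    (hf : ∀ e, P₁ (q (f e)) = g₁ • P₁ (q e)) : ∃ g₂ : G₂, ∀ e, P₂ (q (f e)) = g₂ • P₂ (q e) := by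
  have := h.fst.toContinuousConstSMul
  have := h.snd.toContinuousConstSMul
  obtain ⟨e₀⟩ := (inferInstance : Nonempty E)
  have heq (e : E) : P₁ (q (f e)) = P₁ (g₁ • q e) := (hf e).trans (h.fst_smul g₁ (q e)).symm
  obtain ⟨g₂, hg₂ : g₂ • g₁ • q e₀ = q (f e₀)⟩ := h.fst.apply_eq_iff_mem_orbit.mp (heq e₀)
  -- `g₂` was chosen at the single point `e₀`; uniqueness of lifts through `P₁` on the connected
  -- space `E` extends the equality everywhere.
  have hfun : (fun e => q (f e)) = fun e => g₂ • g₁ • q e := by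
    refine h.fst.isCoveringMap.eq_of_comp_eq (by fun_prop) (by fun_prop) (funext fun e => ?_)
      e₀ hg₂.symm
    exact (heq e).trans (h.fst.map_smul g₂).symm
  refine ⟨g₂, fun e => ?_⟩
  rw [congrFun hfun e, h.snd_smul, h.snd.map_smul]

theorem topologicallyConjugate [ConnectedSpace X₁] [LocallyPathConnectedSpace X₁]
    [LocallyPathConnectedSpace X₂] (h : IsBicovering G₁ G₂ P₁ P₂) {E₁ E₂ : Type*}
    [TopologicalSpace E₁] [TopologicalSpace E₂] {p₁ : E₁ → X₁} {p₂ : E₂ → X₂}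
    (hp₁ : IsUniversalCovering p₁) (hp₂ : IsUniversalCovering p₂) :
    TopologicallyConjugate (liftOfAction G₁ p₁) E₁ (liftOfAction G₂ p₂) E₂ := by
  obtain ⟨x⟩ := (inferInstance : Nonempty X₁)
  obtain ⟨b, rfl⟩ := h.fst.surjective x
  obtain ⟨e₁, he₁⟩ := hp₁.surjective (P₁ b)
  obtain ⟨e₂, he₂⟩ := hp₂.surjective (P₂ b)
  obtain ⟨F, q, -, hq₁, hq₂⟩ := hp₁.exists_homeomorph_of_common_cover hp₂ h.fst.isCoveringMap
    h.snd.isCoveringMap b e₁ e₂ he₁.symm he₂.symm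
  have := hp₁.simplyConnected
  refine topologicallyConjugate_of_mem_iff F fun f => ?_
  have h₁ (e : E₁) : p₁ e = P₁ (q e) := (congrFun hq₁ e).symm
  have h₂ (e : E₁) : p₂ (F e) = P₂ (q e) := (congrFun hq₂ e).symm
  constructor
  · rintro ⟨g₁, hg₁⟩
    obtain ⟨g₂, hg₂⟩ := h.exists_smul_eq q f g₁ fun e => by
      rw [← h₁, ← h₁]
      exact hg₁ e
    refine ⟨g₂, fun e => ?_⟩
    obtain ⟨e, rfl⟩ := F.surjective e
    simpa [h₂] using hg₂ e
  · rintro ⟨g₂, hg₂⟩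
    obtain ⟨g₁, hg₁⟩ := h.symm.exists_smul_eq q f g₂ fun e => by
      rw [← h₂, ← h₂]
      simpa using hg₂ (F e)
    exact ⟨g₁, fun e => by simpa [h₁] using hg₁ e⟩

end IsBicovering

/-! ### The bicovering built from a common lift -/

section Correspondence

variable {G₁ G₂ E X₁ X₂ : Type*} [Group G₁] [Group G₂] [TopologicalSpace E] [MulAction G₁ X₁]
  [MulAction G₂ X₂]

/-- `(g₁, e, g₂)` and `(g₁', h e, g₂')` are related if the homeomorphism `h` covers `g₁'⁻¹ g₁`
along `p₁` and `g₂'⁻¹ g₂` along `p₂`. -/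
def CorrespondenceRel (p₁ : E → X₁) (p₂ : E → X₂) (x y : G₁ × E × G₂) : Prop :=
  ∃ h : E ≃ₜ E, h x.2.1 = y.2.1 ∧ (∀ e, y.1 • p₁ (h e) = x.1 • p₁ e) ∧
    ∀ e, y.2.2 • p₂ (h e) = x.2.2 • p₂ e

/-- The quotient of `G₁ × E × G₂` by the group of homeomorphisms of `E` that cover both an element
of `G₁` along `p₁` and an element of `G₂` along `p₂`. -/
def correspondenceSetoid (G₁ G₂ : Type*) {E X₁ X₂ : Type*} [Group G₁] [Group G₂]
    [TopologicalSpace E] [MulAction G₁ X₁] [MulAction G₂ X₂] (p₁ : E → X₁) (p₂ : E → X₂) :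
    Setoid (G₁ × E × G₂) where
  r := CorrespondenceRel p₁ p₂
  iseqv := by
    refine ⟨fun x => ⟨Homeomorph.refl E, rfl, fun _ => rfl, fun _ => rfl⟩, ?_, ?_⟩
    · rintro x y ⟨h, he, h₁, h₂⟩
      refine ⟨h.symm, by simp [← he], fun e => ?_, fun e => ?_⟩
      · simp [← h₁ (h.symm e)]
      · simp [← h₂ (h.symm e)]
    · rintro x y z ⟨h, he, h₁, h₂⟩ ⟨k, ke, k₁, k₂⟩
      exact ⟨h.trans k, by simp [he, ke], fun e => by simp [k₁, h₁], fun e => by simp [k₂, h₂]⟩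

variable [TopologicalSpace G₁] [DiscreteTopology G₁] [TopologicalSpace G₂] [DiscreteTopology G₂]

theorem isOpenQuotientMap_correspondenceSetoid (p₁ : E → X₁) (p₂ : E → X₂) :
    IsOpenQuotientMap (Quotient.mk (correspondenceSetoid G₁ G₂ p₁ p₂)) := by
  refine ⟨Quotient.mk_surjective, continuous_quotient_mk', fun W hW => ?_⟩
  refine isQuotientMap_quotient_mk'.isOpen_preimage.mp (isOpen_iff_mem_nhds.mpr ?_)
  rintro y ⟨x, hx, hxy⟩
  obtain ⟨h, he, h₁, h₂⟩ := Quotient.exact hxy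
  -- As `h` covers `y.1⁻¹ * x.1` and `y.2.2⁻¹ * x.2.2`, the map `T` moves every point within its
  -- class; it is continuous and sends `y` to `x`, so the saturation of `W` is a neighbourhood of
  -- `y`.
  let T : G₁ × E × G₂ → G₁ × E × G₂ :=
    fun z => (z.1 * (y.1⁻¹ * x.1), h.symm z.2.1, z.2.2 * (y.2.2⁻¹ * x.2.2))
  have hT : Continuous T := by
    refine ((continuous_of_discreteTopology (f := fun g : G₁ => g * (y.1⁻¹ * x.1))).comp
      continuous_fst).prodMk (Continuous.prodMk (by fun_prop)
      ((continuous_of_discreteTopology (f := fun g : G₂ => g * (y.2.2⁻¹ * x.2.2))).comp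
      (by fun_prop)))
  have hTy : T y = x := by simp [T, ← he]
  filter_upwards [hT.continuousAt.preimage_mem_nhds (hW.mem_nhds (hTy.symm ▸ hx))] with z hz
  refine ⟨T z, hz, Quotient.sound ⟨h, by simp [T], fun e => ?_, fun e => ?_⟩⟩
  · simp [T, mul_smul, ← h₁]
  · simp [T, mul_smul, ← h₂]

variable [TopologicalSpace X₁] [TopologicalSpace X₂] [ContinuousConstSMul G₁ X₁]
  [FaithfulSMul G₂ X₂]

/-- Let `B` be the quotient of `G₁ × E × G₂` by the correspondence relation. Then
`(g₁, e, g₂) ↦ g₁ • p₁ e` is the quotient covering of `B` by the action of `G₂`. -/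
theorem isQuotientCoveringMap_of_correspondence [LocallyPathConnectedSpace X₁] {p₁ : E → X₁}
    {p₂ : E → X₂} (hp₁ : IsUniversalCovering p₁) (hp₂ : Function.Surjective p₂)
    (hp : ∀ h : E ≃ₜ E, h ∈ liftOfAction G₁ p₁ → h ∈ liftOfAction G₂ p₂)
    {B : Type*} [TopologicalSpace B] [MulAction G₂ B] {π : G₁ × E × G₂ → B}
    (hπ : IsOpenQuotientMap π) (hπ_iff : ∀ x y, π x = π y ↔ CorrespondenceRel p₁ p₂ x y)
    (hπ_smul : ∀ k g e g', k • π (g, e, g') = π (g, e, k * g')) {P : B → X₁}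
    (hP : ∀ x, P (π x) = x.1 • p₁ x.2.1) : IsQuotientCoveringMap P G₂ := by
  have hcov := hp₁.isCoveringMap
  have hconst : ContinuousConstSMul G₂ B := by
    refine ⟨fun k => hπ.isQuotientMap.continuous_iff.mpr ?_⟩
    have : Continuous fun x : G₁ × E × G₂ => (x.1, x.2.1, k * x.2.2) :=
      continuous_fst.prodMk (Continuous.prodMk (by fun_prop)
        ((continuous_of_discreteTopology (f := fun g : G₂ => k * g)).comp (by fun_prop)))
    exact (hπ.continuous.comp this).congr fun x => (hπ_smul k _ _ _).symm
  have hfree : ∀ (k : G₂) (b : B), k • b = b → k = 1 := by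
    intro k b hb
    obtain ⟨⟨g, e, g'⟩, rfl⟩ := hπ.surjective b
    rw [hπ_smul, hπ_iff] at hb
    obtain ⟨h, he, h₁, h₂⟩ := hb
    -- Here `h` covers the identity of `X₁` and fixes `e`, so it is the identity. Then `k * g'` and
    -- `g'` act alike on `X₂`, and faithfulness gives `k = 1`.
    obtain rfl := hp₁.homeomorph_eq_refl (fun x => smul_left_cancel g (h₁ x)) he
    refine (mul_eq_right (b := g')).mp (eq_of_smul_eq_smul (α := X₂) fun x => ?_)
    obtain ⟨x, rfl⟩ := hp₂ x
    exact (h₂ x).symm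
  have horbit {b b' : B} : P b = P b' ↔ b ∈ MulAction.orbit G₂ b' := by
    constructor
    · intro hbb
      obtain ⟨⟨g, e, k⟩, rfl⟩ := hπ.surjective b'
      obtain ⟨⟨g', e', k'⟩, rfl⟩ := hπ.surjective b
      rw [hP, hP] at hbb
      replace hbb : g' • p₁ e' = g • p₁ e := hbb
      -- Composing `p₁` with `g'⁻¹ * g` gives another universal covering of `X₁`; its isomorphism
      -- with `p₁` taking `e` to `e'` is a lift of `g'⁻¹ * g`.
      obtain ⟨h, he, hh⟩ := (hp₁.homeomorph_comp
        (Homeomorph.smul (g'⁻¹ * g))).exists_homeomorph hp₁ e e' (by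
          simp [mul_smul, ← hbb])
      obtain ⟨l, hl⟩ := hp h ⟨g'⁻¹ * g, hh⟩
      -- This element turns the last coordinate `k` into `k' * l`, and `h`, covering `l` on `X₂`,
      -- relates that to `k'`.
      refine ⟨k' * l * k⁻¹, ?_⟩
      refine (hπ_smul _ _ _ _).trans ((hπ_iff _ _).mpr ⟨h, he, fun x => ?_, fun x => ?_⟩)
      · simp [hh, mul_smul]
      · simp [hl, mul_smul]
    · rintro ⟨k, rfl⟩
      obtain ⟨⟨g, e, g'⟩, rfl⟩ := hπ.surjective b'
      change P (k • π (g, e, g')) = _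
      rw [hπ_smul, hP, hP]
  have hPc : Continuous P := by
    refine hπ.isQuotientMap.continuous_iff.mpr ?_
    have : Continuous fun x : G₁ × X₁ => x.1 • x.2 :=
      continuous_prod_of_discrete_left.mpr continuous_const_smul
    have hc := hcov.continuous
    exact (this.comp (by fun_prop : Continuous fun x : G₁ × E × G₂ => (x.1, p₁ x.2.1))).congr
      fun x => (hP x).symm
  have hPo : IsOpenMap P := by
    refine isOpenMap_iff_nhds_le.mpr fun b => ?_
    obtain ⟨⟨g, e, k⟩, rfl⟩ := hπ.surjective b
    have ho : IsOpenMap fun e => g • p₁ e := (isOpenMap_smul g).comp hcov.isOpenMap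
    have hc : Continuous fun e : E => π (g, e, k) := hπ.continuous.comp (by fun_prop)
    rw [hP]
    refine (ho.nhds_le e).trans ?_
    have := Filter.map_mono (m := P) (hc.tendsto e)
    rw [Filter.map_map] at this
    refine le_trans (le_of_eq ?_) this
    congr 1
    exact funext fun x => (hP (g, x, k)).symm
  have hPs : Function.Surjective P := fun x => by
    obtain ⟨e, rfl⟩ := hp₁.surjective x
    exact ⟨π (1, e, 1), (hP _).trans (one_smul _ _)⟩
  refine ⟨(IsOpenQuotientMap.mk hPs hPc hPo).isQuotientMap, hconst, horbit, fun b => ?_⟩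
  obtain ⟨⟨g, e, k⟩, rfl⟩ := hπ.surjective b
  obtain ⟨U, hU, heU, hinj⟩ := hcov.isLocalHomeomorph.isLocallyInjective e
  -- `p₁` is injective on `U`, so `P` separates the points of this slice. If `l` carries one of them
  -- to another, `P`-invariance makes them equal, and freeness gives `l = 1`.
  refine ⟨π '' ({g} ×ˢ U ×ˢ {k}), (hπ.isOpenMap _ ((isOpen_discrete _).prod
    (hU.prod (isOpen_discrete _)))).mem_nhds ⟨_, ⟨rfl, heU, rfl⟩, rfl⟩, ?_⟩
  rintro l ⟨_, ⟨_, ⟨⟨_, x, _⟩, ⟨rfl, hx, rfl⟩, rfl⟩, rfl⟩, ⟨_, x', _⟩, ⟨rfl, hx', rfl⟩, hl⟩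
  refine hfree l _ (hl.symm.trans ?_)
  have := horbit.mpr ⟨l, hl.symm⟩
  rw [hP, hP] at this
  obtain rfl : x' = x := hinj hx' hx (smul_left_cancel _ this)
  rfl

variable [ContinuousConstSMul G₂ X₂] [FaithfulSMul G₁ X₁]

/-- If the lifts of `(G₁, X₁)` and `(G₂, X₂)` to a common universal covering coincide, then the
quotient of `G₁ × E × G₂` by their common lift is a bicovering of `X₁` and `X₂`. -/
theorem exists_isBicovering_of_liftOfAction_eq
    [LocallyPathConnectedSpace X₁] [LocallyPathConnectedSpace X₂]
    {p₁ : E → X₁} {p₂ : E → X₂}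
    (hp₁ : IsUniversalCovering p₁) (hp₂ : IsUniversalCovering p₂)
    (hp : liftOfAction G₁ p₁ = liftOfAction G₂ p₂) :
    ∃ (_ : MulAction G₁ (Quotient (correspondenceSetoid G₁ G₂ p₁ p₂)))
      (_ : MulAction G₂ (Quotient (correspondenceSetoid G₁ G₂ p₁ p₂)))
      (P₁ : Quotient (correspondenceSetoid G₁ G₂ p₁ p₂) → X₁)
      (P₂ : Quotient (correspondenceSetoid G₁ G₂ p₁ p₂) → X₂), IsBicovering G₁ G₂ P₁ P₂ := by
  let s := correspondenceSetoid G₁ G₂ p₁ p₂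
  let act₁ : MulAction G₁ (Quotient s) :=
    { smul := fun k => Quotient.map (fun x => (k * x.1, x.2)) (by
        rintro x y ⟨h, he, h₁, h₂⟩
        exact ⟨h, he, fun e => by simp [mul_smul, h₁], h₂⟩)
      one_smul := by
        rintro ⟨x⟩
        exact congrArg (Quotient.mk s) (Prod.ext (one_mul _) rfl)
      mul_smul := by
        rintro k l ⟨x⟩
        exact congrArg (Quotient.mk s) (Prod.ext (mul_assoc _ _ _) rfl) }
  let act₂ : MulAction G₂ (Quotient s) :=
    { smul := fun k => Quotient.map (fun x => (x.1, x.2.1, k * x.2.2)) (by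
        rintro x y ⟨h, he, h₁, h₂⟩
        exact ⟨h, he, h₁, fun e => by simp [mul_smul, h₂]⟩)
      one_smul := by
        rintro ⟨x⟩
        exact congrArg (Quotient.mk s) (Prod.ext rfl (Prod.ext rfl (one_mul _)))
      mul_smul := by
        rintro k l ⟨x⟩
        exact congrArg (Quotient.mk s) (Prod.ext rfl (Prod.ext rfl (mul_assoc _ _ _))) }
  let P₁ : Quotient s → X₁ := Quotient.lift (fun x => x.1 • p₁ x.2.1) (by
    rintro x y ⟨h, he, h₁, h₂⟩
    rw [← he, h₁])
  let P₂ : Quotient s → X₂ := Quotient.lift (fun x => x.2.2 • p₂ x.2.1) (by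
    rintro x y ⟨h, he, h₁, h₂⟩
    rw [← he, h₂])
  have hπ := isOpenQuotientMap_correspondenceSetoid (G₁ := G₁) (G₂ := G₂) p₁ p₂
  have hπ_iff (x y : G₁ × E × G₂) : Quotient.mk s x = Quotient.mk s y ↔
      CorrespondenceRel p₁ p₂ x y := ⟨Quotient.exact, fun h => Quotient.sound h⟩
  -- Exchanging the outer factors lets the same lemma handle `P₂` with the indices reversed.
  let σ : G₂ × E × G₁ ≃ₜ G₁ × E × G₂ :=
    { toFun := fun x => (x.2.2, x.2.1, x.1)
      invFun := fun x => (x.2.2, x.2.1, x.1)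
      left_inv := fun _ => rfl
      right_inv := fun _ => rfl }
  refine ⟨act₁, act₂, P₁, P₂, ?_, ?_, ?_, ?_, ?_⟩
  · rintro g₁ g₂ ⟨x⟩
    rfl
  · exact isQuotientCoveringMap_of_correspondence hp₁ hp₂.surjective (fun h hh => hp.le hh) hπ hπ_iff
      (fun _ _ _ _ => rfl) fun _ => rfl
  · refine isQuotientCoveringMap_of_correspondence hp₂ hp₁.surjective (fun h hh => hp.ge hh)
      (hπ.comp σ.isOpenQuotientMap) (fun x y => (hπ_iff _ _).trans ?_) (fun _ _ _ _ => rfl)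
      fun _ => rfl
    exact ⟨fun ⟨h, he, h₁, h₂⟩ => ⟨h, he, h₂, h₁⟩, fun ⟨h, he, h₁, h₂⟩ => ⟨h, he, h₂, h₁⟩⟩
  · rintro g ⟨x⟩
    exact mul_smul _ _ _
  · rintro g ⟨x⟩
    exact mul_smul _ _ _

end Correspondence

/-! ### The main theorem -/

theorem mainTheorem11
    (G₁ X₁ E₁ : Type u) (G₂ X₂ E₂ : Type v)
    [TopologicalSpace X₁] [TopologicalSpace.MetrizableSpace X₁] [LocallyCompactSpace X₁]
    [ConnectedSpace X₁] [LocallyPathConnectedSpace X₁]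
    (hX₁ : IsSemilocallySimplyConnected X₁)
    [TopologicalSpace X₂] [TopologicalSpace.MetrizableSpace X₂] [LocallyCompactSpace X₂]
    [ConnectedSpace X₂] [LocallyPathConnectedSpace X₂]
    (hX₂ : IsSemilocallySimplyConnected X₂)
    [Group G₁] [TopologicalSpace G₁] [DiscreteTopology G₁]
    [MulAction G₁ X₁] [ContinuousConstSMul G₁ X₁] [FaithfulSMul G₁ X₁]
    [Group G₂] [TopologicalSpace G₂] [DiscreteTopology G₂]
    [MulAction G₂ X₂] [ContinuousConstSMul G₂ X₂] [FaithfulSMul G₂ X₂]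
    [TopologicalSpace E₁] (p₁ : E₁ → X₁) (hp₁ : IsUniversalCovering p₁)
    [TopologicalSpace E₂] (p₂ : E₂ → X₂) (hp₂ : IsUniversalCovering p₂) :
    (actionGroupoid G₁ X₁).AreEquivalent (actionGroupoid G₂ X₂) ↔
      TopologicallyConjugate (liftOfAction G₁ p₁) E₁ (liftOfAction G₂ p₂) E₂ := by
  constructor
  · rintro ⟨B, _, _, _, ⟨e⟩⟩
    let := e.left.mulAction
    let := e.right.mulAction
    exact e.isBicovering.topologicallyConjugate hp₁ hp₂
  · intro h
    obtain ⟨F, hF⟩ := h.exists_mem_iff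
    have hp₂' := hp₂.comp_homeomorph F
    -- Pulling `p₂` back along `F` turns conjugate lifts into equal subgroups of the homeomorphisms
    -- of `E₁`.
    have heq : liftOfAction G₁ p₁ = liftOfAction G₂ (p₂ ∘ F) := by
      ext f
      rw [hF]
      refine exists_congr fun g => F.symm.toEquiv.forall_congr fun e => ?_
      simp
    obtain ⟨_, _, P₁, P₂, hB⟩ := exists_isBicovering_of_liftOfAction_eq hp₁ hp₂' heq
    -- `E₁` is locally modelled on `X₁`, hence locally compact; this passes to `G₁ × E₁ × G₂` and
    -- then to its open quotient.
    let := hp₁.isCoveringMap.chartedSpace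
    have := ChartedSpace.locallyCompactSpace X₁ E₁
    exact ⟨_, inferInstance,
      (isOpenQuotientMap_correspondenceSetoid p₁ (p₂ ∘ F)).locallyCompactSpace,
      hB.fst.isCoveringMap.t2Space, hB.nonempty_equivalence⟩
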